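/- Let $X$ be a real inner product space of finite dimension at least $2$ (for example $\mathbb{R}^n$ with $n\ge 2$), and let $F$ assign to each $x\in X$ a set $F(x)\subseteq X$ of admissible velocities such that: (SH1) each $F(x)$ is nonempty and convex, the graph $\{(x,v): v\in F(x)\}$ is closed in $X\times X$, and for each compact $K\subset X$ there is $M>0$ with $\|v\|\le M$ for all $x\in K$, $v\in F(x)$; (SH2) there are $\gamma,c>0$ with $\|v\|\le\gamma\|x\|+c$ for all $x\in X$, $v\in F(x)$; (SH3) for each compact $K\subset X$ there is $k>0$ with $F(x)\subseteq F(y)+k\|x-y\|\,\overline{B_1(0)}$ for all $x,y\in K$. Let $\psi:X\times X\to(0,\infty)$ be continuous, let $X_{obst}\subseteq X$ be closed, and put $X_{free}=X\setminus X_{obst}$. An admissible trajectory from $x$ to $y$ is an absolutely continuous map $\pi:[0,T]\to X$, for some $T\ge 0$, with $\pi(0)=x$, $\pi(T)=y$, $\dot\pi(t)\in F(\pi(t))$ for a.e. $t\in[0,T]$, and $\pi(t)\in\overline{X_{free}}$ for all $t\in[0,T]$. Its cost is $c_\pi=\int_0^T\psi(\pi(t),\dot\pi(t))\,dt$. Let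 $d_c(x,y)$ be the infimum of $c_\pi$ over all admissible trajectories $\pi$ from $x$ to $y$ ($\infty$ if there are none), and for $\rho>0$ put $$\mathcal F_\rho(x)=\{y\in X: d_c(x,y)<\rho\},\qquad \mathcal R_\rho(x)=\{y\in X: d_c(y,x)<\rho\}.$$ Let $h_F(x,\xi)=\inf_{v\in F(x)}\langle v,\xi\rangle$ and $B_r(x)=\{y\in X:\|x-y\|<r\}$. **Theorem.** Suppose $x\in X_{free}$ and $\xi\in X$ satisfy $h_F(x,\xi)>0$. Then for every $r>0$ there exists $\rho>0$ such that $$\bigl(\partial\mathcal R_\rho(x)\cap\partial\mathcal R_\mu(x)\cap B_r(x)\bigr)\setminus\{x\}\neq\emptyset\qquad\text{for all }0<\mu<\rho,$$ and $$\bigl(\partial\mathcal F_\rho(x)\cap\partial\mathcal F_\mu(x)\cap B_r(x)\bigr)\setminus\{x\}\neq\emptyset\qquad\text{for all }0<\mu<\rho.$$ -/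

import Mathlib

open scoped Pointwise ENNReal

namespace ControlReach

variable {E : Type*} [NormedAddCommGroup E] [InnerProductSpace ℝ E]

/-- Standing hypotheses on the velocity multifunction `F`: nonempty convex values, closed graph,
local boundedness, linear growth, local Lipschitz regularity. -/
structure StandingHypotheses (F : E → Set E) : Prop where
  nonempty : ∀ x, (F x).Nonempty
  convex : ∀ x, Convex ℝ (F x)
  closed_graph : IsClosed {p : E × E | p.2 ∈ F p.1}
  locally_bounded : ∀ K : Set E, IsCompact K → ∃ M : ℝ, 0 < M ∧ ∀ x ∈ K, ∀ v ∈ F x, ‖v‖ ≤ M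
  linear_growth : ∃ γ c : ℝ, 0 < γ ∧ 0 < c ∧ ∀ x, ∀ v ∈ F x, ‖v‖ ≤ γ * ‖x‖ + c
  locally_lipschitz : ∀ K : Set E, IsCompact K → ∃ k : ℝ, 0 < k ∧ ∀ x ∈ K, ∀ y ∈ K,
    F x ⊆ F y + (k * ‖x - y‖) • Metric.closedBall (0 : E) 1

/-- The minimal Hamiltonian `h_F(x, ξ) = inf_{v ∈ F(x)} ⟨v, ξ⟩`. Under the standing hypotheses
the infimum is over a nonempty bounded set of reals. -/
noncomputable def minHamiltonian (F : E → Set E) (x ξ : E) : ℝ :=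
  sInf ((fun v : E => inner ℝ v ξ) '' F x)

/-- `p : [0, T] → E` is an absolutely continuous solution of `p' ∈ F(p)` a.e. with `p 0 = x` and
`p T = y`, for some `T ≥ 0` (values of `p` outside `[0, T]` play no role). -/
structure IsTrajectory (F : E → Set E) (x y : E) (T : ℝ) (p : ℝ → E) : Prop where
  time_nonneg : 0 ≤ T
  abs_cont : AbsolutelyContinuousOnInterval p 0 T
  velocity : ∀ᵐ t ∂(MeasureTheory.volume.restrict (Set.Icc (0 : ℝ) T)),
    DifferentiableAt ℝ p t ∧ deriv p t ∈ F (p t)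
  start_eq : p 0 = x
  end_eq : p T = y

/-- An admissible trajectory stays in the closure of the free space, the complement of the
obstacle set `O`. -/
def IsAdmissible (F : E → Set E) (O : Set E) (x y : E) (T : ℝ) (p : ℝ → E) : Prop :=
  IsTrajectory F x y T p ∧ ∀ t ∈ Set.Icc (0 : ℝ) T, p t ∈ closure Oᶜ

/-- The cost `∫₀ᵀ ψ(p(t), p'(t)) dt` of a trajectory, for a positive running cost `ψ`. -/
noncomputable def cost (ψ : E × E → ℝ) (T : ℝ) (p : ℝ → E) : ℝ≥0∞ :=
  ∫⁻ t in Set.Icc (0 : ℝ) T, ENNReal.ofReal (ψ (p t, deriv p t))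

/-- The cost-distance from `x` to `y`; it is `∞` if no admissible trajectory moves `x` to `y`. -/
noncomputable def costDist (F : E → Set E) (O : Set E) (ψ : E × E → ℝ) (x y : E) : ℝ≥0∞ :=
  ⨅ (T : ℝ) (p : ℝ → E) (_ : IsAdmissible F O x y T p), cost ψ T p

/-- The forward reachable set of radius `ρ`. -/
def forwardReach (F : E → Set E) (O : Set E) (ψ : E × E → ℝ) (ρ : ℝ) (x : E) : Set E :=
  {y | costDist F O ψ x y < ENNReal.ofReal ρ}

/-- The reverse reachable set of radius `ρ`. -/
def reverseReach (F : E → Set E) (O : Set E) (ψ : E × E → ℝ) (ρ : ℝ) (x : E) : Set E :=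
  {y | x ∈ forwardReach F O ψ ρ y}

end ControlReach

namespace ControlReach

open MeasureTheory Set Filter Topology

/-! ### Local existence of continuously differentiable solutions. -/

section Existence

variable {E : Type*} [NormedAddCommGroup E] [InnerProductSpace ℝ E]

/-! Call `⟨y - x, ξ⟩` the height of `y`. Near `x` every velocity raises the height at rate at least
some `c > 0`, and the running cost lies between constants `m, B > 0`. Cheap trajectories cannot
leave a small ball (`IsTrajectory.mem_ball_of_cost_lt`), so one that ends at height below `c * μ /
B` lasts less than `μ / B` and costs less than `μ`. Hence the forward sets of radii `ρ` and `μ`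
coincide in the half-space of heights below `c * μ / B`, and so do their frontiers there.

A short trajectory (`exists_solution`) reaches a point of small positive height. The line through it
orthogonal to `ξ` stays at that height and meets the frontier of the bounded forward set; positive
height separates this frontier point from `x`. Reverse sets are forward sets for `-F`, with `-ξ` in
place of `ξ`. -/

theorem StandingHypotheses.isClosed_values {F : E → Set E} (hF : StandingHypotheses F) (x : E) :
    IsClosed (F x) :=
  hF.closed_graph.preimage (Continuous.prodMk_right x)

theorem StandingHypotheses.exists_dist_le {F : E → Set E} {K : Set E} {k : ℝ} (hk : 0 < k)
    (h : ∀ x ∈ K, ∀ y ∈ K, F x ⊆ F y + (k * ‖x - y‖) • Metric.closedBall (0 : E) 1)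
    {x y v : E} (hx : x ∈ K) (hy : y ∈ K) (hv : v ∈ F x) :
    ∃ w ∈ F y, ‖v - w‖ ≤ k * ‖x - y‖ := by
  obtain ⟨w, hw, e, he, rfl⟩ := Set.mem_add.1 (h x hx y hy hv)
  obtain ⟨b, hb, rfl⟩ := Set.mem_smul_set.1 he
  refine ⟨w, hw, ?_⟩
  have hb' : ‖b‖ ≤ 1 := by simpa using hb
  rw [add_sub_cancel_left, norm_smul, Real.norm_of_nonneg (by positivity)]
  exact mul_le_of_le_one_right (by positivity) hb'

theorem StandingHypotheses.neg {F : E → Set E} (hF : StandingHypotheses F) :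
    StandingHypotheses (fun x => -F x) where
  nonempty x := (hF.nonempty x).neg
  convex x := (hF.convex x).neg
  closed_graph := hF.closed_graph.preimage (continuous_fst.prodMk continuous_snd.neg)
  locally_bounded K hK := by
    obtain ⟨M, hM, h⟩ := hF.locally_bounded K hK
    exact ⟨M, hM, fun x hx v hv => by simpa using h x hx (-v) hv⟩
  linear_growth := by
    obtain ⟨γ, c, hγ, hc, h⟩ := hF.linear_growth
    exact ⟨γ, c, hγ, hc, fun x v hv => by simpa using h x (-v) hv⟩
  locally_lipschitz K hK := by
    obtain ⟨k, hk, h⟩ := hF.locally_lipschitz K hK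
    refine ⟨k, hk, fun x hx y hy v hv => ?_⟩
    obtain ⟨w, hw, e, he, hwe⟩ := Set.mem_add.1 (h x hx y hy hv)
    obtain ⟨b, hb, rfl⟩ := Set.mem_smul_set.1 he
    refine Set.mem_add.2 ⟨-w, by simpa using hw, (k * ‖x - y‖) • (-b),
      Set.smul_mem_smul_set (by simpa using hb), ?_⟩
    rw [smul_neg, ← neg_add, hwe, neg_neg]

variable [FiniteDimensional ℝ E]

/-- The nearest-point selection of a multifunction satisfying the standing hypotheses is
jointly continuous in the base point and in the point that is projected. -/
theorem StandingHypotheses.exists_continuous_nearest {F : E → Set E}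
    (hF : StandingHypotheses F) :
    ∃ P : E × E → E, Continuous P ∧ (∀ q, P q ∈ F q.1) ∧
      ∀ q, ∀ a ∈ F q.1, ‖q.2 - P q‖ ≤ ‖q.2 - a‖ := by
  have hex : ∀ q : E × E, ∃ v ∈ F q.1, ‖q.2 - v‖ = ⨅ w : F q.1, ‖q.2 - w‖ := fun q =>
    exists_norm_eq_iInf_of_complete_convex (hF.nonempty q.1) (hF.isClosed_values q.1).isComplete
      (hF.convex q.1) q.2
  choose P hPmem hPmin using hex
  have hvar : ∀ q, ∀ a ∈ F q.1, inner ℝ (q.2 - P q) (a - P q) ≤ 0 := fun q =>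
    (norm_eq_iInf_iff_real_inner_le_zero (hF.convex q.1) (hPmem q)).1 (hPmin q)
  refine ⟨P, ?_, hPmem, fun q a ha => ?_⟩
  · refine continuous_iff_continuousAt.2 fun q₀ => ?_
    set K := Metric.closedBall q₀.1 1
    have hK : IsCompact K := isCompact_closedBall _ _
    obtain ⟨M, hM, hMb⟩ := hF.locally_bounded K hK
    obtain ⟨k, hk, hkL⟩ := hF.locally_lipschitz K hK
    have hq₀ : q₀.1 ∈ K := Metric.mem_closedBall_self zero_le_one
    have hnear : ∀ᶠ q : E × E in 𝓝 q₀, q.1 ∈ K :=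
      continuous_fst.continuousAt.eventually_mem (Metric.closedBall_mem_nhds _ one_pos)
    have hbound : ∀ᶠ q in 𝓝 q₀, ‖P q - P q₀‖ ^ 2 ≤
        ‖q.2 - q₀.2‖ * (2 * M) + (‖q.2‖ + ‖q₀.2‖ + 2 * M) * (k * ‖q.1 - q₀.1‖) := by
      filter_upwards [hnear] with q hq
      obtain ⟨a, ha, hae⟩ := exists_dist_le hk hkL hq₀ hq (hPmem q₀)
      obtain ⟨b, hb, hbe⟩ := exists_dist_le hk hkL hq hq₀ (hPmem q)
      rw [norm_sub_rev q₀.1] at hae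
      have h1 := hvar q a ha
      have h2 := hvar q₀ b hb
      have hu := hMb _ hq _ (hPmem q)
      have hu₀ := hMb _ hq₀ _ (hPmem q₀)
      generalize P q = u at *
      generalize P q₀ = u₀ at *
      set δ := k * ‖q.1 - q₀.1‖
      have hδ : 0 ≤ δ := by positivity
      have h3 : inner ℝ (q.2 - u) (u₀ - a) ≤ (‖q.2‖ + M) * δ :=
        (real_inner_le_norm _ _).trans (mul_le_mul ((norm_sub_le _ _).trans (by linarith)) hae
          (norm_nonneg _) (by positivity))
      have h4 : inner ℝ (q₀.2 - u₀) (u - b) ≤ (‖q₀.2‖ + M) * δ :=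
        (real_inner_le_norm _ _).trans (mul_le_mul ((norm_sub_le _ _).trans (by linarith)) hbe
          (norm_nonneg _) (by positivity))
      have h5 : inner ℝ (q.2 - q₀.2) (u - u₀) ≤ ‖q.2 - q₀.2‖ * (2 * M) :=
        (real_inner_le_norm _ _).trans (mul_le_mul_of_nonneg_left
          ((norm_sub_le _ _).trans (by linarith)) (norm_nonneg _))
      -- The third and fifth terms are nonpositive by the variational inequalities `h1` and `h2`;
      -- the others vanish as `q → q₀`.
      have h6 : ‖u - u₀‖ ^ 2 = inner ℝ (q.2 - q₀.2) (u - u₀)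
          + inner ℝ (q.2 - u) (u₀ - a) + inner ℝ (q.2 - u) (a - u)
          + inner ℝ (q₀.2 - u₀) (u - b) + inner ℝ (q₀.2 - u₀) (b - u₀) := by
        rw [← real_inner_self_eq_norm_sq]
        simp only [inner_sub_left, inner_sub_right, real_inner_comm]
        ring
      linarith
    have hlim : Tendsto (fun q : E × E => ‖q.2 - q₀.2‖ * (2 * M) +
        (‖q.2‖ + ‖q₀.2‖ + 2 * M) * (k * ‖q.1 - q₀.1‖)) (𝓝 q₀) (𝓝 0) := by
      have : Continuous (fun q : E × E => ‖q.2 - q₀.2‖ * (2 * M) +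
        (‖q.2‖ + ‖q₀.2‖ + 2 * M) * (k * ‖q.1 - q₀.1‖)) := by fun_prop
      simpa using this.tendsto q₀
    have hsq : Tendsto (fun q => ‖P q - P q₀‖ ^ 2) (𝓝 q₀) (𝓝 0) :=
      squeeze_zero' (Eventually.of_forall fun _ => by positivity) hbound hlim
    have := (Real.continuous_sqrt.tendsto 0).comp hsq
    rw [Real.sqrt_zero] at this
    refine tendsto_iff_norm_sub_tendsto_zero.2 (this.congr fun q => ?_)
    simp [Real.sqrt_sq]
  · rw [hPmin]
    exact ciInf_le ⟨0, Set.forall_mem_range.2 fun _ => norm_nonneg _⟩ (⟨a, ha⟩ : F q.1)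

/-- Picard-type iteration on velocities: integrate the current velocity, then project it onto `F`
along the resulting curve. On a short interval this contracts by `1 / 2`, and the closed graph
passes the inclusion to the uniform limit. -/
theorem StandingHypotheses.exists_solution {F : E → Set E} (hF : StandingHypotheses F) (x : E)
    {R : ℝ} (hR : 0 < R) :
    ∃ T₀ : ℝ, 0 < T₀ ∧ ∃ p v : ℝ → E, Continuous v ∧ (∀ t, HasDerivAt p (v t) t) ∧ p 0 = x ∧
      ∀ t ∈ Icc 0 T₀, v t ∈ F (p t) ∧ p t ∈ Metric.closedBall x R := by
  obtain ⟨P, hPc, hPF, hPmin⟩ := hF.exists_continuous_nearest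
  have hK : IsCompact (Metric.closedBall x R) := isCompact_closedBall _ _
  obtain ⟨M, hM, hMb⟩ := hF.locally_bounded _ hK
  obtain ⟨k, hk, hkL⟩ := hF.locally_lipschitz _ hK
  have hxK : x ∈ Metric.closedBall x R := Metric.mem_closedBall_self hR.le
  obtain ⟨v₀, hv₀⟩ := hF.nonempty x
  -- The first bound confines curves of speed at most `M` to the ball; the second gives the
  -- contraction factor.
  set T := min (R / M) (1 / (2 * k)) with hT
  have hT0 : 0 < T := by positivity
  have hTM : M * T ≤ R := by
    have : T ≤ R / M := min_le_left _ _
    rw [le_div_iff₀ hM] at this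
    linarith
  have hTk : k * T ≤ 1 / 2 := by
    have : T ≤ 1 / (2 * k) := min_le_right _ _
    rw [le_div_iff₀ (by positivity)] at this
    linarith
  -- Clamping time to `[0, T]` makes the estimates uniform over all of `ℝ`.
  let cl : ℝ → ℝ := fun t => max 0 (min t T)
  have hcl : Continuous cl := by fun_prop
  have hcl0 : ∀ t, 0 ≤ cl t := fun t => le_max_left _ _
  have hclT : ∀ t, cl t ≤ T := fun t => max_le hT0.le (min_le_right _ _)
  let pos : (ℝ → E) → ℝ → E := fun v t => x + ∫ s in (0 : ℝ)..cl t, v s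
  have hposc : ∀ v, Continuous v → Continuous (pos v) := fun v hv =>
    continuous_const.add
      ((intervalIntegral.continuous_primitive (fun a b => hv.intervalIntegrable a b) 0).comp hcl)
  have hposd : ∀ v w, Continuous v → Continuous w → ∀ C, (∀ t, ‖v t - w t‖ ≤ C) →
      ∀ t, ‖pos v t - pos w t‖ ≤ C * T := by
    intro v w hv hw C hC t
    have hC0 : 0 ≤ C := (norm_nonneg _).trans (hC 0)
    simp only [pos, add_sub_add_left_eq_sub]
    rw [← intervalIntegral.integral_sub (hv.intervalIntegrable _ _) (hw.intervalIntegrable _ _)]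
    refine (intervalIntegral.norm_integral_le_of_norm_le_const fun s _ => hC s).trans ?_
    rw [sub_zero, abs_of_nonneg (hcl0 t)]
    exact mul_le_mul_of_nonneg_left (hclT t) hC0
  have hposb : ∀ v, Continuous v → (∀ t, ‖v t‖ ≤ M) → ∀ t, pos v t ∈ Metric.closedBall x R := by
    intro v hv hvM t
    have := hposd v (fun _ => 0) hv continuous_const M (by simpa using hvM) t
    rw [mem_closedBall_iff_norm]
    simp only [pos, intervalIntegral.integral_zero, add_zero] at this
    exact this.trans hTM
  let step : (ℝ → E) → ℝ → E := fun v t => P (pos v t, v t)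
  let V : ℕ → ℝ → E := fun n => step^[n] fun _ => v₀
  have hVs : ∀ n t, V (n + 1) t = P (pos (V n) t, V n t) := fun n t => by
    simp only [V, Function.iterate_succ_apply', step]
  have hV : ∀ n, Continuous (V n) ∧ ∀ t, ‖V n t‖ ≤ M := by
    intro n
    induction n with
    | zero => exact ⟨continuous_const, fun t => hMb x hxK v₀ hv₀⟩
    | succ n ih =>
      refine ⟨?_, fun t => ?_⟩
      · rw [show V (n + 1) = _ from funext (hVs n)]
        exact hPc.comp ((hposc _ ih.1).prodMk ih.1)
      · rw [hVs]
        exact hMb _ (hposb _ ih.1 ih.2 t) _ (hPF (pos (V n) t, V n t))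
  have hVpos : ∀ n t, pos (V n) t ∈ Metric.closedBall x R := fun n =>
    hposb _ (hV n).1 (hV n).2
  have hVF : ∀ n t, V (n + 1) t ∈ F (pos (V n) t) := fun n t => by
    rw [hVs]; exact hPF (pos (V n) t, V n t)
  have hdist : ∀ n t, ‖V (n + 1) t - V n t‖ ≤ 4 * M / 2 / 2 ^ n := by
    intro n
    induction n with
    | zero =>
      intro t
      refine (norm_sub_le _ _).trans ?_
      have h1 := (hV 1).2 t
      have h0 := (hV 0).2 t
      norm_num at *
      linarith
    | succ n ih =>
      intro t
      -- `V (n + 1) t` lies in `F` at the previous position, so `F` at the new position has a point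
      -- `w` close to it; the projection is at least as close.
      obtain ⟨w, hw, hwd⟩ := exists_dist_le hk hkL (hVpos n t) (hVpos (n + 1) t) (hVF n t)
      have h1 := hPmin (pos (V (n + 1)) t, V (n + 1) t) w hw
      rw [← hVs] at h1
      have h2 := hposd _ _ (hV (n + 1)).1 (hV n).1 _ ih t
      rw [norm_sub_rev] at h1 h2
      calc _ ≤ k * ‖pos (V n) t - pos (V (n + 1)) t‖ := h1.trans hwd
        _ ≤ k * (4 * M / 2 / 2 ^ n * T) := by gcongr
        _ = (k * T) * (4 * M / 2 / 2 ^ n) := by ring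
        _ ≤ 1 / 2 * (4 * M / 2 / 2 ^ n) := by gcongr
        _ = 4 * M / 2 / 2 ^ (n + 1) := by rw [pow_succ]; ring
  have hdist' : ∀ t n, dist (V n t) (V (n + 1) t) ≤ 4 * M / 2 / 2 ^ n := fun t n => by
    rw [dist_comm, dist_eq_norm]; exact hdist n t
  have hlim : ∀ t, ∃ v, Tendsto (fun n => V n t) atTop (𝓝 v) := fun t =>
    cauchySeq_tendsto_of_complete (cauchySeq_of_le_geometric_two (hdist' t))
  choose v hv using hlim
  have hVv : ∀ n t, ‖V n t - v t‖ ≤ 4 * M / 2 ^ n := fun n t => by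
    rw [← dist_eq_norm]
    exact dist_le_of_le_geometric_two_of_tendsto (hdist' t) (hv t) n
  have hgeo : Tendsto (fun n : ℕ => 4 * M / (2 : ℝ) ^ n) atTop (𝓝 0) :=
    tendsto_const_nhds.div_atTop (tendsto_pow_atTop_atTop_of_one_lt one_lt_two)
  have hvc : Continuous v := by
    have : TendstoUniformly V v atTop := by
      refine Metric.tendstoUniformly_iff.2 fun ε hε => ?_
      filter_upwards [hgeo.eventually (gt_mem_nhds hε)] with n hn t
      rw [dist_comm, dist_eq_norm]
      exact (hVv n t).trans_lt hn
    exact this.continuous (Frequently.of_forall fun n => (hV n).1)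
  have hpos_lim : ∀ t, Tendsto (fun n => pos (V n) t) atTop (𝓝 (pos v t)) := fun t => by
    refine tendsto_iff_norm_sub_tendsto_zero.2 (squeeze_zero (fun _ => norm_nonneg _)
      (fun n => hposd _ _ (hV n).1 hvc _ (hVv n) t) ?_)
    simpa using hgeo.mul_const T
  refine ⟨T, hT0, fun t => x + ∫ s in (0 : ℝ)..t, v s, v, hvc, fun t => ?_, by simp,
    fun t ht => ?_⟩
  · exact (hvc.integral_hasStrictDerivAt 0 t).hasDerivAt.const_add x
  · have hclt : cl t = t := by simp [cl, ht.1, ht.2]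
    have hp : pos v t = x + ∫ s in (0 : ℝ)..t, v s := by simp only [pos, hclt]
    simp only [← hp]
    refine ⟨?_, ?_⟩
    · exact hF.closed_graph.mem_of_tendsto
        ((hpos_lim t).prodMk_nhds ((tendsto_add_atTop_iff_nat 1).2 (hv t)))
        (Eventually.of_forall fun n => hVF n t)
    · exact hK.isClosed.mem_of_tendsto (hpos_lim t) (Eventually.of_forall fun n => hVpos n t)

end Existence

/-! ### Time reversal exchanges reverse and forward reachability. -/

section TimeReversal

theorem _root_.AbsolutelyContinuousOnInterval.comp_const_sub {X : Type*} [PseudoMetricSpace X]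
    {p : ℝ → X} {T : ℝ} (hp : AbsolutelyContinuousOnInterval p 0 T) :
    AbsolutelyContinuousOnInterval (fun t => p (T - t)) 0 T := by
  rw [absolutelyContinuousOnInterval_iff] at hp ⊢
  intro ε hε
  obtain ⟨δ, hδ, h⟩ := hp ε hε
  refine ⟨δ, hδ, fun ⟨n, I⟩ ⟨hI, hdisj⟩ hlen => ?_⟩
  refine h (n, fun i => (T - (I i).1, T - (I i).2)) ⟨fun i hi => ?_, fun i hi j hj hij => ?_⟩ ?_
  · obtain ⟨h1, h2⟩ := hI i hi
    simp only [mem_uIcc] at h1 h2 ⊢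
    constructor <;> grind
  · have := hdisj hi hj hij
    simp only [Function.onFun, uIoc, Ioc_disjoint_Ioc] at this ⊢
    grind
  · simpa only [dist_sub_left] using hlen

variable {E : Type*} [NormedAddCommGroup E] [InnerProductSpace ℝ E]

theorem preimage_const_sub_Icc_zero (T : ℝ) : (fun t => T - t) ⁻¹' Icc 0 T = Icc 0 T := by
  simp

theorem IsAdmissible.reverse {F : E → Set E} {O : Set E} {x y : E} {T : ℝ} {p : ℝ → E}
    (h : IsAdmissible F O y x T p) :
    IsAdmissible (fun z => -F z) O x y T (fun t => p (T - t)) := by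
  obtain ⟨h, hO⟩ := h
  refine ⟨⟨h.time_nonneg, h.abs_cont.comp_const_sub, ?_, by simp [h.end_eq],
    by simp [h.start_eq]⟩, fun t ht => hO _ ?_⟩
  · have hmp := ((volume : Measure ℝ).measurePreserving_sub_left T).restrict_preimage
      (measurableSet_Icc (a := 0) (b := T))
    rw [preimage_const_sub_Icc_zero] at hmp
    filter_upwards [hmp.quasiMeasurePreserving.ae h.velocity] with t ⟨hd, hv⟩
    refine ⟨hd.comp t (differentiableAt_id.const_sub T), ?_⟩
    rw [deriv_comp_const_sub]
    simpa using hv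
  · rwa [← preimage_const_sub_Icc_zero] at ht

theorem cost_reverse (ψ : E × E → ℝ) (T : ℝ) (p : ℝ → E) :
    cost (fun q => ψ (q.1, -q.2)) T (fun t => p (T - t)) = cost ψ T p := by
  have := ((volume : Measure ℝ).measurePreserving_sub_left T).setLIntegral_comp_preimage_emb
    (Homeomorph.subLeft T).measurableEmbedding
    (fun t => ENNReal.ofReal (ψ (p t, deriv p t))) (Icc 0 T)
  rw [preimage_const_sub_Icc_zero] at this
  simpa only [cost, deriv_comp_const_sub, neg_neg] using this

theorem costDist_reverse_le (F : E → Set E) (O : Set E) (ψ : E × E → ℝ) (x y : E) :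
    costDist (fun z => -F z) O (fun q => ψ (q.1, -q.2)) x y ≤ costDist F O ψ y x :=
  le_iInf fun T => le_iInf fun p => le_iInf fun h =>
    (iInf_le_of_le T (iInf_le_of_le (fun t => p (T - t)) (iInf_le _ h.reverse))).trans
      (cost_reverse ψ T p).le

theorem costDist_reverse (F : E → Set E) (O : Set E) (ψ : E × E → ℝ) (x y : E) :
    costDist (fun z => -F z) O (fun q => ψ (q.1, -q.2)) x y = costDist F O ψ y x := by
  refine (costDist_reverse_le F O ψ x y).antisymm ?_
  -- Reversal is an involution, so the same inequality for the reversed data is the converse.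
  simpa only [neg_neg] using
    costDist_reverse_le (fun z => -F z) O (fun q => ψ (q.1, -q.2)) y x

theorem reverseReach_eq_forwardReach (F : E → Set E) (O : Set E) (ψ : E × E → ℝ) (ρ : ℝ) (x : E) :
    reverseReach F O ψ ρ x =
      forwardReach (fun z => -F z) O (fun q => ψ (q.1, -q.2)) ρ x := by
  ext y
  simp only [reverseReach, forwardReach, mem_ofPred_eq, costDist_reverse]

end TimeReversal

/-! ### Displacement bounds for absolutely continuous curves. -/

section Displacement

variable {E : Type*} [NormedAddCommGroup E] [InnerProductSpace ℝ E]

theorem mul_le_inner_sub_of_ae_le_inner_deriv {p : ℝ → E} {τ c : ℝ} {u : E} (hτ : 0 ≤ τ)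
    (hp : AbsolutelyContinuousOnInterval p 0 τ)
    (h : ∀ᵐ t ∂volume.restrict (Icc 0 τ), DifferentiableAt ℝ p t ∧ c ≤ inner ℝ (deriv p t) u) :
    c * τ ≤ inner ℝ (p τ - p 0) u := by
  let g : ℝ → ℝ := fun t => inner ℝ (p t) u
  have hlip : LipschitzWith ‖u‖₊ (fun y : E => (inner ℝ y u : ℝ)) := by
    refine LipschitzWith.of_dist_le_mul fun a b => ?_
    rw [Real.dist_eq, ← inner_sub_left, dist_eq_norm, mul_comm]
    exact abs_real_inner_le_norm _ _
  have hg : AbsolutelyContinuousOnInterval g 0 τ := by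
    rw [absolutelyContinuousOnInterval_iff] at hp ⊢
    intro ε hε
    obtain ⟨δ, hδ, hδ'⟩ := hp (ε / (‖u‖ + 1)) (by positivity)
    refine ⟨δ, hδ, fun I hI hlen => ?_⟩
    have h1 := hδ' I hI hlen
    rw [lt_div_iff₀ (by positivity)] at h1
    refine lt_of_le_of_lt ?_ h1
    rw [Finset.sum_mul]
    refine Finset.sum_le_sum fun i _ => (hlip.dist_le_mul _ _).trans ?_
    rw [mul_comm, coe_nnnorm]
    gcongr
    linarith
  have hder : ∀ᵐ t ∂volume.restrict (Icc 0 τ), c ≤ deriv g t := by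
    filter_upwards [h] with t ⟨hd, hc⟩
    have : HasDerivAt g (inner ℝ (deriv p t) u) t := by
      simpa using hd.hasDerivAt.inner ℝ (hasDerivAt_const t u)
    rwa [this.deriv]
  have hint := hg.integral_deriv_eq_sub
  have := intervalIntegral.integral_mono_ae_restrict hτ
    (intervalIntegrable_const (c := c)) hg.intervalIntegrable_deriv hder
  rw [hint, intervalIntegral.integral_const, smul_eq_mul, sub_zero, mul_comm] at this
  simpa only [g, inner_sub_left] using this

theorem norm_sub_le_of_ae_norm_deriv_le {p : ℝ → E} {τ M : ℝ} (hτ : 0 ≤ τ)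
    (hp : AbsolutelyContinuousOnInterval p 0 τ)
    (h : ∀ᵐ t ∂volume.restrict (Icc 0 τ), DifferentiableAt ℝ p t ∧ ‖deriv p t‖ ≤ M) (hM : 0 ≤ M) :
    ‖p τ - p 0‖ ≤ M * τ := by
  set w := p τ - p 0 with hw
  rcases (norm_nonneg w).eq_or_lt with h0 | h0
  · rw [← h0]; positivity
  -- Testing against the displacement itself turns the scalar bound into a norm bound.
  have := mul_le_inner_sub_of_ae_le_inner_deriv (u := -w) (c := -(M * ‖w‖)) hτ hp (by
    filter_upwards [h] with t ⟨hd, hb⟩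
    refine ⟨hd, ?_⟩
    rw [inner_neg_right]
    exact neg_le_neg ((real_inner_le_norm _ _).trans (by gcongr)))
  rw [← hw, inner_neg_right, real_inner_self_eq_norm_sq] at this
  refine le_of_mul_le_mul_right ?_ h0
  nlinarith

end Displacement

/-! ### Estimates near `x` and the shared frontier points. -/

section Local

variable {E : Type*} [NormedAddCommGroup E] [InnerProductSpace ℝ E]

/-- Reaching distance `R` at speed at most `M` takes time at least `R / M`, which costs at least `m
* R / M`. The argument stops at the first such time, so the bounds on the ball apply up to it. -/
theorem IsTrajectory.mem_ball_of_cost_lt {F : E → Set E} {ψ : E × E → ℝ} {x y : E} {T : ℝ}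
    {p : ℝ → E} {R M m : ℝ} (h : IsTrajectory F x y T p) (hM : 0 < M) (hm : 0 < m)
    (hMb : ∀ z ∈ Metric.closedBall x R, ∀ v ∈ F z, ‖v‖ ≤ M)
    (hmb : ∀ z ∈ Metric.closedBall x R, ∀ v ∈ F z, m ≤ ψ (z, v))
    (hcost : cost ψ T p < ENNReal.ofReal (m * R / M)) :
    ∀ t ∈ Icc 0 T, p t ∈ Metric.ball x R := by
  by_contra! hcon
  have hpc : ContinuousOn p (Icc 0 T) := by
    simpa [uIcc_of_le h.time_nonneg] using h.abs_cont.continuousOn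
  set S := {t ∈ Icc 0 T | R ≤ ‖p t - x‖} with hS
  have hScl : IsClosed S := isClosed_Icc.isClosed_le continuousOn_const
    (hpc.sub continuousOn_const).norm
  have hSc : IsCompact S := isCompact_Icc.of_isClosed_subset hScl fun t ht => ht.1
  obtain ⟨t₀, ht₀, ht₀'⟩ := hcon
  obtain ⟨τ, ⟨⟨hτ0, hτT⟩, hτR⟩, hmin⟩ := hSc.exists_isLeast
    ⟨t₀, ht₀, by simpa [← dist_eq_norm] using ht₀'⟩
  have hsub : Icc 0 τ ⊆ Icc 0 T := Icc_subset_Icc_right hτT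
  have hvel : ∀ᵐ t ∂volume.restrict (Icc 0 τ), DifferentiableAt ℝ p t ∧ deriv p t ∈ F (p t) ∧
      p t ∈ Metric.closedBall x R := by
    have hne : ∀ᵐ t ∂volume.restrict (Icc 0 τ), t ≠ τ :=
      ae_restrict_of_ae (compl_mem_ae_iff.2 (measure_singleton τ))
    filter_upwards [ae_mono (Measure.restrict_mono hsub le_rfl) h.velocity, hne,
      ae_restrict_mem measurableSet_Icc] with t ⟨hd, hv⟩ hne ht
    refine ⟨hd, hv, ?_⟩
    rw [mem_closedBall_iff_norm]
    by_contra! hlt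
    exact hne (le_antisymm ht.2 (hmin ⟨hsub ht, hlt.le⟩))
  have hac : AbsolutelyContinuousOnInterval p 0 τ := h.abs_cont.mono (by
    rwa [uIcc_of_le hτ0, uIcc_of_le h.time_nonneg])
  have hlen : R ≤ M * τ := by
    refine hτR.trans ?_
    rw [← h.start_eq]
    exact norm_sub_le_of_ae_norm_deriv_le hτ0 hac
      (hvel.mono fun t ⟨hd, hv, hb⟩ => ⟨hd, hMb _ hb _ hv⟩) hM.le
  refine hcost.not_ge ?_
  calc ENNReal.ofReal (m * R / M) ≤ ENNReal.ofReal (m * τ) := by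
        refine ENNReal.ofReal_le_ofReal ?_
        rw [div_le_iff₀ hM]
        nlinarith
    _ = ∫⁻ _ in Icc 0 τ, ENNReal.ofReal m := by
        rw [setLIntegral_const, Real.volume_Icc, sub_zero, ENNReal.ofReal_mul hm.le]
    _ ≤ ∫⁻ t in Icc 0 τ, ENNReal.ofReal (ψ (p t, deriv p t)) :=
        lintegral_mono_ae (hvel.mono fun t ⟨_, hv, hb⟩ =>
          ENNReal.ofReal_le_ofReal (hmb _ hb _ hv))
    _ ≤ cost ψ T p := lintegral_mono_set hsub

theorem IsTrajectory.cost_le {F : E → Set E} {ψ : E × E → ℝ} {x y : E} {T : ℝ}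
    {p : ℝ → E} {K : Set E} {B : ℝ} (h : IsTrajectory F x y T p) (hB : 0 ≤ B)
    (hK : ∀ t ∈ Icc 0 T, p t ∈ K) (hBb : ∀ z ∈ K, ∀ v ∈ F z, ψ (z, v) ≤ B) :
    cost ψ T p ≤ ENNReal.ofReal (B * T) := by
  calc cost ψ T p ≤ ∫⁻ _ in Icc 0 T, ENNReal.ofReal B := by
        refine lintegral_mono_ae ?_
        filter_upwards [h.velocity, ae_restrict_mem measurableSet_Icc] with t ⟨_, hv⟩ ht
        exact ENNReal.ofReal_le_ofReal (hBb _ (hK t ht) _ hv)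
    _ = ENNReal.ofReal (B * T) := by
        rw [setLIntegral_const, Real.volume_Icc, sub_zero, ENNReal.ofReal_mul hB]

theorem IsTrajectory.mul_time_le_inner {F : E → Set E} {x y ξ : E} {T : ℝ}
    {p : ℝ → E} {K : Set E} {c : ℝ} (h : IsTrajectory F x y T p)
    (hK : ∀ t ∈ Icc 0 T, p t ∈ K) (hc : ∀ z ∈ K, ∀ v ∈ F z, c ≤ inner ℝ v ξ) :
    c * T ≤ inner ℝ (y - x) ξ := by
  have := mul_le_inner_sub_of_ae_le_inner_deriv (u := ξ) (c := c) h.time_nonneg h.abs_cont (by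
    filter_upwards [h.velocity, ae_restrict_mem measurableSet_Icc] with t ⟨hd, hv⟩ ht
    exact ⟨hd, hc _ (hK t ht) _ hv⟩)
  rwa [h.start_eq, h.end_eq] at this

theorem exists_isAdmissible_of_mem_forwardReach {F : E → Set E} {O : Set E} {ψ : E × E → ℝ}
    {ρ : ℝ} {x y : E} (h : y ∈ forwardReach F O ψ ρ x) :
    ∃ T p, IsAdmissible F O x y T p ∧ cost ψ T p < ENNReal.ofReal ρ := by
  simpa [forwardReach, costDist, iInf_lt_iff] using h

theorem IsAdmissible.mem_forwardReach {F : E → Set E} {O : Set E} {ψ : E × E → ℝ}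
    {ρ : ℝ} {x y : E} {T : ℝ} {p : ℝ → E} (h : IsAdmissible F O x y T p)
    (hc : cost ψ T p < ENNReal.ofReal ρ) : y ∈ forwardReach F O ψ ρ x :=
  (iInf_le_of_le T (iInf_le_of_le p (iInf_le _ h))).trans_lt hc

theorem forwardReach_mono {F : E → Set E} {O : Set E} {ψ : E × E → ℝ} {μ ρ : ℝ} (h : μ ≤ ρ)
    (x : E) : forwardReach F O ψ μ x ⊆ forwardReach F O ψ ρ x :=
  fun _ hy => lt_of_lt_of_le hy (ENNReal.ofReal_le_ofReal h)

/-- Near `x`, velocities keep a uniformly positive component along `ξ`. -/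
theorem StandingHypotheses.exists_ball_le_inner [FiniteDimensional ℝ E] {F : E → Set E}
    (hF : StandingHypotheses F) {x ξ : E} (hξ : 0 < minHamiltonian F x ξ) :
    ∃ R > 0, ∀ z ∈ Metric.closedBall x R, ∀ v ∈ F z, minHamiltonian F x ξ / 2 ≤ inner ℝ v ξ := by
  set H := minHamiltonian F x ξ with hH
  obtain ⟨M, hM, hMb⟩ := hF.locally_bounded _ (isCompact_closedBall x 1)
  obtain ⟨k, hk, hkL⟩ := hF.locally_lipschitz _ (isCompact_closedBall x 1)
  have hx : x ∈ Metric.closedBall x 1 := Metric.mem_closedBall_self zero_le_one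
  have hbdd : BddBelow ((fun v : E => (inner ℝ v ξ : ℝ)) '' F x) := by
    refine ⟨-(M * ‖ξ‖), ?_⟩
    rintro _ ⟨v, hv, rfl⟩
    have := (abs_le.1 (abs_real_inner_le_norm v ξ)).1
    have := mul_le_mul_of_nonneg_right (hMb x hx v hv) (norm_nonneg ξ)
    simp only
    linarith
  refine ⟨min 1 (H / (2 * (k * (‖ξ‖ + 1)))), by positivity, fun z hz v hv => ?_⟩
  rw [mem_closedBall_iff_norm] at hz
  have hz1 : z ∈ Metric.closedBall x 1 := mem_closedBall_iff_norm.2 (hz.trans (min_le_left _ _))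
  have hz2 := hz.trans (min_le_right _ _)
  obtain ⟨w, hw, hwd⟩ := exists_dist_le hk hkL hz1 hx hv
  have h1 : H ≤ inner ℝ w ξ := csInf_le hbdd ⟨w, hw, rfl⟩
  have h2 := (abs_le.1 (abs_real_inner_le_norm (v - w) ξ)).1
  rw [inner_sub_left] at h2
  have h3 : ‖v - w‖ * ‖ξ‖ ≤ H / 2 := by
    rw [le_div_iff₀ (by positivity)] at hz2
    have : ‖v - w‖ * ‖ξ‖ ≤ k * ‖z - x‖ * (‖ξ‖ + 1) := by gcongr; linarith
    linarith
  linarith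

/-- The one place where dimension at least 2 enters. -/
theorem exists_ne_zero_inner_eq_zero (hdim : 2 ≤ Module.finrank ℝ E) (ξ : E) :
    ∃ w : E, w ≠ 0 ∧ inner ℝ w ξ = 0 := by
  have : FiniteDimensional ℝ E := Module.finite_of_finrank_pos (by omega)
  have h1 := (ℝ ∙ ξ).finrank_add_finrank_orthogonal
  have h2 : Module.finrank ℝ (ℝ ∙ ξ) ≤ 1 := by
    simpa using finrank_span_le_card (R := ℝ) ({ξ} : Set E)
  have : Nontrivial (ℝ ∙ ξ)ᗮ := Module.nontrivial_of_finrank_pos (R := ℝ) (by omega)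
  obtain ⟨w, hw⟩ := exists_ne (0 : (ℝ ∙ ξ)ᗮ)
  exact ⟨w, by simpa using hw, by
    rw [real_inner_comm]; exact Submodule.mem_orthogonal_singleton_iff_inner_right.1 w.2⟩

/-- A bounded set has a frontier point on each line that meets it. -/
theorem exists_add_smul_mem_frontier {S : Set E} (hS : Bornology.IsBounded S) {z w : E}
    (hz : z ∈ S) (hw : w ≠ 0) : ∃ s : ℝ, z + s • w ∈ frontier S := by
  let l : ℝ → E := fun s => z + s • w
  have hl : Continuous l := by fun_prop
  obtain ⟨C, hC⟩ := hS.exists_norm_le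
  have hw' : 0 < ‖w‖ := norm_pos_iff.2 hw
  have hne : l ⁻¹' S ≠ univ := by
    intro h
    have hs : l ((C + ‖z‖ + 1) / ‖w‖) ∈ S := by
      rw [← mem_preimage, h]; trivial
    have h1 := hC _ hs
    have hC0 : 0 ≤ C := (norm_nonneg _).trans h1
    have h2 : ‖((C + ‖z‖ + 1) / ‖w‖) • w‖ = C + ‖z‖ + 1 := by
      rw [norm_smul, Real.norm_of_nonneg (by positivity), div_mul_cancel₀ _ hw'.ne']
    have h3 := norm_sub_le (l ((C + ‖z‖ + 1) / ‖w‖)) z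
    simp only [l, add_sub_cancel_left, h2] at h3 h1
    linarith
  -- `ℝ` is connected, so a nonempty proper subset has a frontier point.
  obtain ⟨s, hs⟩ := nonempty_frontier_iff.2 ⟨⟨0, by simpa [l] using hz⟩, hne⟩
  exact ⟨s, hl.frontier_preimage_subset S hs⟩

theorem mem_frontier_of_inter_eq {X : Type*} [TopologicalSpace X] {A B U : Set X} (hU : IsOpen U)
    (h : A ∩ U = B ∩ U) {a : X} (ha : a ∈ frontier A) (haU : a ∈ U) : a ∈ frontier B := by
  have h1 : a ∈ frontier (A ∩ U) ∩ U := by rw [frontier_inter_open_inter hU]; exact ⟨ha, haU⟩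
  rw [h, frontier_inter_open_inter hU] at h1
  exact h1.1

/-- All forward reachable sets of small radius share frontier points close to, and different
from, the starting point. -/
theorem exists_forwardReach_frontier [FiniteDimensional ℝ E] (hdim : 2 ≤ Module.finrank ℝ E)
    {F : E → Set E} (hF : StandingHypotheses F)
    {ψ : E × E → ℝ} (hψ : Continuous ψ) (hψ_pos : ∀ q, 0 < ψ q)
    {O : Set E} (hO : IsClosed O)
    {x ξ : E} (hx : x ∈ Oᶜ) (hξ : 0 < minHamiltonian F x ξ)
    {r : ℝ} (hr : 0 < r) :
    ∃ ρ₀ : ℝ, 0 < ρ₀ ∧ ∀ ρ ≤ ρ₀, ∀ μ : ℝ, 0 < μ → μ < ρ →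
        ((frontier (forwardReach F O ψ ρ x) ∩
          frontier (forwardReach F O ψ μ x) ∩ Metric.ball x r) \ {x}).Nonempty := by
  obtain ⟨R₁, hR₁, hinner₁⟩ := hF.exists_ball_le_inner hξ
  obtain ⟨R₂, hR₂, hfree₂⟩ := Metric.isOpen_iff.1 hO.isOpen_compl x hx
  set R := min R₁ (min (R₂ / 2) (r / 2)) with hRdef
  have hR : 0 < R := by positivity
  have hRr : R < r := ((min_le_right _ _).trans (min_le_right _ _)).trans_lt (half_lt_self hr)
  have hRR₂ : R < R₂ := ((min_le_right _ _).trans (min_le_left _ _)).trans_lt (half_lt_self hR₂)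
  set K := Metric.closedBall x R with hKdef
  have hKc : IsCompact K := isCompact_closedBall _ _
  set c := minHamiltonian F x ξ / 2 with hcdef
  have hc : 0 < c := half_pos hξ
  have hinner : ∀ z ∈ K, ∀ v ∈ F z, c ≤ inner ℝ v ξ := fun z hz =>
    hinner₁ z (Metric.closedBall_subset_closedBall (min_le_left _ _) hz)
  have hfree : K ⊆ Oᶜ := (Metric.closedBall_subset_ball hRR₂).trans hfree₂
  obtain ⟨M, hM, hMb⟩ := hF.locally_bounded K hKc
  have hKK : IsCompact (K ×ˢ Metric.closedBall (0 : E) M) := hKc.prod (isCompact_closedBall _ _)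
  have hmemKK : ∀ z ∈ K, ∀ v ∈ F z, (z, v) ∈ K ×ˢ Metric.closedBall (0 : E) M :=
    fun z hz v hv => ⟨hz, by simpa using hMb z hz v hv⟩
  have hxK : x ∈ K := Metric.mem_closedBall_self hR.le
  have hKKne : (K ×ˢ Metric.closedBall (0 : E) M).Nonempty :=
    (hF.nonempty x).elim fun v hv => ⟨_, hmemKK x hxK v hv⟩
  obtain ⟨q₁, -, hq₁⟩ := hKK.exists_isMinOn hKKne hψ.continuousOn
  obtain ⟨q₂, -, hq₂⟩ := hKK.exists_isMaxOn hKKne hψ.continuousOn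
  set m := ψ q₁
  set B := ψ q₂
  have hm : 0 < m := hψ_pos _
  have hB : 0 < B := hψ_pos _
  have hmb : ∀ z ∈ K, ∀ v ∈ F z, m ≤ ψ (z, v) := fun z hz v hv => hq₁ (hmemKK z hz v hv)
  have hBb : ∀ z ∈ K, ∀ v ∈ F z, ψ (z, v) ≤ B := fun z hz v hv => hq₂ (hmemKK z hz v hv)
  refine ⟨m * R / M, by positivity, fun ρ hρ μ hμ hμρ => ?_⟩
  have hconf : ∀ y T p, IsAdmissible F O x y T p → cost ψ T p < ENNReal.ofReal ρ →
      ∀ t ∈ Icc 0 T, p t ∈ K := fun y T p h hcost t ht =>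
    Metric.ball_subset_closedBall (h.1.mem_ball_of_cost_lt hM hm hMb hmb
      (hcost.trans_le (ENNReal.ofReal_le_ofReal hρ)) t ht)
  have hbound : forwardReach F O ψ ρ x ⊆ K := by
    intro y hy
    obtain ⟨T, p, h, hcost⟩ := exists_isAdmissible_of_mem_forwardReach hy
    have := hconf y T p h hcost T ⟨h.1.time_nonneg, le_rfl⟩
    rwa [h.1.end_eq] at this
  -- Below this height the duration is less than `μ / B`, hence the cost less than `μ`.
  set U : Set E := {y | inner ℝ (y - x) ξ < c * μ / B} with hUdef
  have hU : IsOpen U := isOpen_lt (by fun_prop) continuous_const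
  have hagree : forwardReach F O ψ ρ x ∩ U = forwardReach F O ψ μ x ∩ U := by
    refine Subset.antisymm ?_ (inter_subset_inter_left _ (forwardReach_mono hμρ.le x))
    rintro y ⟨hy, hyU⟩
    refine ⟨?_, hyU⟩
    obtain ⟨T, p, h, hcost⟩ := exists_isAdmissible_of_mem_forwardReach hy
    have hpK := hconf y T p h hcost
    refine h.mem_forwardReach ((h.1.cost_le hB.le hpK hBb).trans_lt ?_)
    rw [ENNReal.ofReal_lt_ofReal_iff hμ]
    have h1 := (h.1.mul_time_le_inner hpK hinner).trans_lt hyU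
    rw [lt_div_iff₀ hB] at h1
    refine lt_of_mul_lt_mul_left ?_ hc.le
    linarith
  obtain ⟨T₀, hT₀, p, v, hv, hpv, hp0, hpF⟩ := hF.exists_solution x hR
  have hpc : Continuous p := continuous_iff_continuousAt.2 fun t => (hpv t).continuousAt
  -- A short enough run of the solution ends inside `U` and costs less than `ρ`.
  have hsmall : ∀ᶠ T in 𝓝 (0 : ℝ), p T ∈ U ∧ B * T < ρ := by
    refine (hpc.continuousAt.eventually_mem (hU.mem_nhds ?_)).and
      ((continuous_const.mul continuous_id).continuousAt.eventually_lt continuousAt_const ?_)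
    · simp only [hUdef, mem_ofPred_eq, hp0, sub_self, inner_zero_left]
      positivity
    · simpa using hμ.trans hμρ
  obtain ⟨T, ⟨hTU, hTρ⟩, hT0, hTT₀⟩ := ((hsmall.filter_mono nhdsWithin_le_nhds).and
    (Ioc_mem_nhdsGT hT₀)).exists
  have hTsub : Icc 0 T ⊆ Icc 0 T₀ := Icc_subset_Icc_right hTT₀
  have htraj : IsAdmissible F O x (p T) T p := by
    refine ⟨⟨hT0.le, ?_, ?_, hp0, rfl⟩, fun t ht => subset_closure (hfree (hpF t (hTsub ht)).2)⟩
    · refine ContDiffOn.absolutelyContinuousOnInterval (ContDiff.contDiffOn ?_)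
      refine contDiff_one_iff_deriv.2 ⟨fun t => (hpv t).differentiableAt, ?_⟩
      rwa [show deriv p = v from funext fun t => (hpv t).deriv]
    · filter_upwards [ae_restrict_mem measurableSet_Icc] with t ht
      refine ⟨(hpv t).differentiableAt, ?_⟩
      rw [(hpv t).deriv]
      exact (hpF t (hTsub ht)).1
  have hpK : ∀ t ∈ Icc 0 T, p t ∈ K := fun t ht => (hpF t (hTsub ht)).2
  have hz : p T ∈ forwardReach F O ψ ρ x :=
    htraj.mem_forwardReach ((htraj.1.cost_le hB.le hpK hBb).trans_lt
      ((ENNReal.ofReal_lt_ofReal_iff (hμ.trans hμρ)).2 hTρ))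
  have hzpos : 0 < inner ℝ (p T - x) ξ :=
    (mul_pos hc hT0).trans_le (htraj.1.mul_time_le_inner hpK hinner)
  obtain ⟨w, hw, hwξ⟩ := exists_ne_zero_inner_eq_zero hdim ξ
  obtain ⟨s, hs⟩ := exists_add_smul_mem_frontier (hKc.isBounded.subset hbound) hz hw
  have hheight : inner ℝ (p T + s • w - x) ξ = inner ℝ (p T - x) ξ := by
    rw [add_sub_right_comm, inner_add_left, inner_smul_left, hwξ, mul_zero, add_zero]
  have hsU : p T + s • w ∈ U := by
    rw [hUdef, mem_ofPred_eq, hheight]; exact hTU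
  refine ⟨p T + s • w, ⟨⟨hs, mem_frontier_of_inter_eq hU hagree hs hsU⟩, ?_⟩, ?_⟩
  · exact Metric.closedBall_subset_ball hRr
      (closure_minimal hbound hKc.isClosed (frontier_subset_closure hs))
  · intro h
    rw [mem_singleton_iff] at h
    rw [h, sub_self, inner_zero_left] at hheight
    exact hzpos.ne hheight

/-- Carries the positivity hypothesis over to the reversed system. -/
theorem minHamiltonian_neg (F : E → Set E) (x ξ : E) :
    minHamiltonian (fun z => -F z) x (-ξ) = minHamiltonian F x ξ := by
  simp only [minHamiltonian, ← image_neg_eq_neg, image_image, inner_neg_neg]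

end Local

end ControlReach

theorem mainTheorem6 {E : Type*} [NormedAddCommGroup E] [InnerProductSpace ℝ E]
    [FiniteDimensional ℝ E] (hdim : 2 ≤ Module.finrank ℝ E)
    (F : E → Set E) (hF : ControlReach.StandingHypotheses F)
    (ψ : E × E → ℝ) (hψ : Continuous ψ) (hψ_pos : ∀ q, 0 < ψ q)
    (O : Set E) (hO : IsClosed O)
    (x ξ : E) (hx : x ∈ Oᶜ) (hξ : 0 < ControlReach.minHamiltonian F x ξ)
    (r : ℝ) (hr : 0 < r) :
    ∃ ρ : ℝ, 0 < ρ ∧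
      (∀ μ : ℝ, 0 < μ → μ < ρ →
        ((frontier (ControlReach.reverseReach F O ψ ρ x) ∩
          frontier (ControlReach.reverseReach F O ψ μ x) ∩ Metric.ball x r) \ {x}).Nonempty) ∧
      (∀ μ : ℝ, 0 < μ → μ < ρ →
        ((frontier (ControlReach.forwardReach F O ψ ρ x) ∩
          frontier (ControlReach.forwardReach F O ψ μ x) ∩ Metric.ball x r) \ {x}).Nonempty) := by
  obtain ⟨ρ₁, hρ₁, h₁⟩ :=
    ControlReach.exists_forwardReach_frontier hdim hF hψ hψ_pos hO hx hξ hr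
  obtain ⟨ρ₂, hρ₂, h₂⟩ :=
    ControlReach.exists_forwardReach_frontier (ψ := fun q => ψ (q.1, -q.2)) (ξ := -ξ) hdim hF.neg
      (by fun_prop) (fun _ => hψ_pos _) hO hx (by rwa [ControlReach.minHamiltonian_neg]) hr
  -- Each threshold works for all smaller radii, so the minimum serves both directions.
  refine ⟨min ρ₁ ρ₂, lt_min hρ₁ hρ₂, fun μ hμ hμρ => ?_, h₁ _ (min_le_left _ _)⟩
  simp only [ControlReach.reverseReach_eq_forwardReach]
  exact h₂ _ (min_le_right _ _) μ hμ hμρ
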